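/- Let $A \in \mathbb{Z}^{m \times m}$ be a square integer matrix that is not nilpotent. For an integer matrix $M$, let $\gcd(M)$ denote the greatest common divisor of all the entries of $M$, normalized to be nonnegative. Then the sequence of rational numbers \[ g(n) := \frac{\gcd(A^{n+1})}{\gcd(A^n)}, \qquad n \in \mathbb{N}, \] is eventually periodic, i.e., there exist $n_0 \in \mathbb{N}$ and a positive integer $T$ such that $g(n+T)=g(n)$ for all $n \geq n_0$. -/

import Mathlib

/-- The greatest common divisor of all entries of an integer matrix, normalized to be
nonnegative. -/
def Matrix.entriesGcd {k l : ℕ} (M : Matrix (Fin k) (Fin l) ℤ) : ℤ :=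
  (Finset.univ : Finset (Fin k × Fin l)).gcd fun ij => M ij.1 ij.2

/-- A sequence of rational numbers is eventually periodic if, from some threshold `n₀` on, it
satisfies `f (n + T) = f n` for a fixed positive integer `T`. -/
def EventuallyPeriodicSeq (f : ℕ → ℚ) : Prop :=
  ∃ n₀ T : ℕ, 0 < T ∧ ∀ n : ℕ, n₀ ≤ n → f (n + T) = f n

section PowerGrowth

open Polynomial

attribute [local instance] Matrix.normedAddCommGroup Matrix.normedSpace

variable {ι : Type*} [Fintype ι] {K : Type*} [NormedField K]

/-! Work one prime at a time: the sup norm of `A ^ n` over `ℚ_[p]` records the `p`-adic valuation of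
the entry gcd. It is squeezed between `‖r‖ ^ n` and `C * ‖r‖ ^ n` for a dominant eigenvalue `r`, and
some `‖r‖ ^ T` equals `‖x‖` with `x` in `ℚ_[p]`. So the matrices `x⁻ᵏ A ^ (T * k)` are bounded;
compactness gives two close ones, and the ultrametric inequality turns closeness into the exact law
of `Matrix.eventually_norm_pow_add_padic`. Only finitely many primes matter, so their periods have a
common multiple. -/

theorem Matrix.exists_root_charpoly_ne_zero [DecidableEq ι] [IsAlgClosed K]
    {M : Matrix ι ι K} (hM : ¬ IsNilpotent M) : ∃ r ∈ M.charpoly.roots, r ≠ 0 := by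
  by_contra! h
  have hs := (IsAlgClosed.splits M.charpoly).eq_prod_roots_of_monic M.charpoly_monic
  rw [Multiset.eq_replicate_card.2 h] at hs
  simp only [Multiset.map_replicate, C_0, sub_zero, Multiset.prod_replicate] at hs
  have := M.aeval_self_charpoly
  rw [hs, map_pow, aeval_X] at this
  exact hM ⟨_, this⟩

section Ultrametric

variable [IsUltrametricDist K]

theorem norm_coeff_prod_X_sub_C_le_one (s : Multiset K) (hs : ∀ a ∈ s, ‖a‖ ≤ 1) (i : ℕ) :
    ‖((s.map fun a => X - C a).prod).coeff i‖ ≤ 1 := by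
  induction s using Multiset.induction_on generalizing i with
  | empty =>
    simp only [Multiset.map_zero, Multiset.prod_zero, coeff_one]
    split_ifs <;> simp
  | cons a s ih =>
    have ih := ih fun b hb => hs b (Multiset.mem_cons_of_mem hb)
    have ha := hs a (Multiset.mem_cons_self a s)
    have hmul (j : ℕ) : ‖a * ((s.map fun a => X - C a).prod).coeff j‖ ≤ 1 := by
      rw [norm_mul]
      exact mul_le_one₀ ha (norm_nonneg _) (ih j)
    rw [Multiset.map_cons, Multiset.prod_cons, sub_mul, coeff_sub, coeff_C_mul]
    cases i with
    | zero => simpa [coeff_X_mul_zero] using hmul 0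
    | succ j =>
      rw [coeff_X_mul, sub_eq_add_neg]
      refine (IsUltrametricDist.norm_add_le_max _ _).trans (max_le (ih j) ?_)
      rw [norm_neg]
      exact hmul _

theorem Matrix.norm_mul_le_of_ultrametric (M N : Matrix ι ι K) : ‖M * N‖ ≤ ‖M‖ * ‖N‖ := by
  rw [Matrix.norm_le_iff (by positivity)]
  intro i j
  rw [Matrix.mul_apply]
  refine IsUltrametricDist.norm_sum_le_of_forall_le_of_nonneg (by positivity) fun k _ => ?_
  rw [norm_mul]
  exact mul_le_mul (Matrix.norm_entry_le_entrywise_sup_norm M)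
    (Matrix.norm_entry_le_entrywise_sup_norm N) (norm_nonneg _) (norm_nonneg _)

theorem Matrix.norm_mulVec_le_of_ultrametric (M : Matrix ι ι K) (v : ι → K) :
    ‖M.mulVec v‖ ≤ ‖M‖ * ‖v‖ := by
  rw [pi_norm_le_iff_of_nonneg (by positivity)]
  intro i
  refine IsUltrametricDist.norm_sum_le_of_forall_le_of_nonneg (by positivity) fun k _ => ?_
  rw [norm_mul]
  exact mul_le_mul (Matrix.norm_entry_le_entrywise_sup_norm M)
    (norm_le_pi_norm v k) (norm_nonneg _) (norm_nonneg _)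

variable [DecidableEq ι]

/-- Cayley–Hamilton expresses each high power through the `d` preceding ones with coefficients of
norm at most 1, so ultrametrically the norms cannot grow. -/
theorem Matrix.exists_norm_pow_le_of_charpoly_coeff (M : Matrix ι ι K)
    (hM : ∀ i, ‖M.charpoly.coeff i‖ ≤ 1) : ∃ C : ℝ, 0 ≤ C ∧ ∀ n : ℕ, ‖M ^ n‖ ≤ C := by
  set d := Fintype.card ι with hd
  set C := ∑ i ∈ Finset.range d, ‖M ^ i‖ with hC
  have hC0 : 0 ≤ C := Finset.sum_nonneg fun _ _ => norm_nonneg _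
  have hrec : M ^ d = -∑ i ∈ Finset.range d, M.charpoly.coeff i • M ^ i := by
    have h := M.aeval_self_charpoly
    rw [aeval_eq_sum_range, M.charpoly_natDegree_eq_dim, Finset.sum_range_succ] at h
    have h1 : M.charpoly.coeff (Fintype.card ι) = 1 := by
      rw [← M.charpoly_natDegree_eq_dim]
      exact M.charpoly_monic
    rw [h1, one_smul] at h
    exact eq_neg_of_add_eq_zero_right h
  have : IsUltrametricDist (Matrix ι ι K) :=
    inferInstanceAs (IsUltrametricDist (ι → ι → K))
  refine ⟨C, hC0, fun n => ?_⟩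
  induction n using Nat.strong_induction_on with
  | _ n ih =>
    by_cases hn : n < d
    · exact Finset.single_le_sum (f := fun i => ‖M ^ i‖) (fun _ _ => norm_nonneg _)
        (Finset.mem_range.2 hn)
    · have hsplit : M ^ n = -∑ i ∈ Finset.range d, M.charpoly.coeff i • M ^ (n - d + i) := by
        conv_lhs => rw [← Nat.sub_add_cancel (not_lt.1 hn), pow_add, hrec]
        simp [Finset.mul_sum, pow_add]
      rw [hsplit, norm_neg]
      refine IsUltrametricDist.norm_sum_le_of_forall_le_of_nonneg hC0 fun i hi => ?_
      rw [norm_smul]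
      have := Finset.mem_range.1 hi
      exact (mul_le_of_le_one_left (norm_nonneg _) (hM i)).trans (ih _ (by omega))

theorem Matrix.norm_pow_le_norm_pow_of_mem_spectrum {M : Matrix ι ι K} {r : K}
    (hr : r ∈ spectrum K M) (n : ℕ) : ‖r‖ ^ n ≤ ‖M ^ n‖ := by
  have hr' : r ^ n ∈ spectrum K (M ^ n) := spectrum.pow_mem_pow M n hr
  rw [← Matrix.spectrum_toLin', ← Module.End.hasEigenvalue_iff_mem_spectrum] at hr'
  obtain ⟨v, hv⟩ := hr'.exists_hasEigenvector
  have hv1 := hv.apply_eq_smul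
  rw [Matrix.toLin'_apply] at hv1
  have h := Matrix.norm_mulVec_le_of_ultrametric (M ^ n) v
  rw [hv1, norm_smul, norm_pow] at h
  exact le_of_mul_le_mul_right h (norm_pos_iff.2 hv.2)

/-- Over an algebraically closed ultrametric field, the powers of a matrix which is not nilpotent
grow like the powers of a dominant eigenvalue. -/
theorem Matrix.exists_norm_pow_bounds [IsAlgClosed K] {M : Matrix ι ι K} (hM : ¬ IsNilpotent M) :
    ∃ (r : K) (C : ℝ), r ≠ 0 ∧ 0 ≤ C ∧
      ∀ n : ℕ, ‖r‖ ^ n ≤ ‖M ^ n‖ ∧ ‖M ^ n‖ ≤ C * ‖r‖ ^ n := by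
  classical
  obtain ⟨r₀, hr₀, hr₀0⟩ := Matrix.exists_root_charpoly_ne_zero hM
  obtain ⟨r, hr, hmax⟩ := Finset.exists_max_image M.charpoly.roots.toFinset (fun x => ‖x‖)
    ⟨r₀, Multiset.mem_toFinset.2 hr₀⟩
  have hr0 : r ≠ 0 := by
    rw [← norm_pos_iff]
    exact (norm_pos_iff.2 hr₀0).trans_le (hmax r₀ (Multiset.mem_toFinset.2 hr₀))
  have hrs : r ∈ spectrum K M :=
    Matrix.mem_spectrum_iff_isRoot_charpoly.2 (isRoot_of_mem_roots (Multiset.mem_toFinset.1 hr))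
  have hscale (n : ℕ) : (r⁻¹ • M) ^ n = (r⁻¹) ^ n • M ^ n := smul_pow _ _ _
  -- Dividing by the dominant eigenvalue moves all eigenvalues into the unit ball.
  obtain ⟨C, hC0, hC⟩ := (r⁻¹ • M).exists_norm_pow_le_of_charpoly_coeff (by
    rw [(IsAlgClosed.splits (r⁻¹ • M).charpoly).eq_prod_roots_of_monic (charpoly_monic _)]
    refine norm_coeff_prod_X_sub_C_le_one _ fun a ha => ?_
    have ha' : a ∈ spectrum K (r⁻¹ • M) :=
      Matrix.mem_spectrum_iff_isRoot_charpoly.2 (isRoot_of_mem_roots ha)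
    have hra : r * a ∈ spectrum K M := by
      have := (spectrum.smul_mem_smul_iff (a := r⁻¹ • M) (s := a) (r := Units.mk0 r hr0)).2 ha'
      simpa [Units.smul_def, smul_smul, hr0] using this
    have hle := hmax (r * a) (by
      rw [Multiset.mem_toFinset, mem_roots (charpoly_monic M).ne_zero]
      exact Matrix.mem_spectrum_iff_isRoot_charpoly.1 hra)
    rw [norm_mul] at hle
    exact le_of_mul_le_mul_left (by simpa using hle) (norm_pos_iff.2 hr0))
  refine ⟨r, C, hr0, hC0, fun n => ⟨Matrix.norm_pow_le_norm_pow_of_mem_spectrum hrs n, ?_⟩⟩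
  have h := hC n
  rw [hscale, norm_smul, norm_pow, norm_inv, inv_pow, inv_mul_eq_div,
    div_le_iff₀ (pow_pos (norm_pos_iff.2 hr0) n)] at h
  exact h

end Ultrametric

end PowerGrowth

section Padic

attribute [local instance] Matrix.normedAddCommGroup Matrix.normedSpace

variable {p : ℕ} [Fact p.Prime]

/-- The norm is the spectral norm, which the constant coefficient of the minimal polynomial
determines. -/
theorem PadicAlgCl.exists_norm_pow_eq_norm {r : PadicAlgCl p} (hr : r ≠ 0) :
    ∃ (T : ℕ) (x : ℚ_[p]), 0 < T ∧ x ≠ 0 ∧ ‖r‖ ^ T = ‖x‖ := by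
  have hint : IsIntegral ℚ_[p] r := Algebra.IsIntegral.isIntegral r
  have hd : 0 < (minpoly ℚ_[p] r).natDegree := minpoly.natDegree_pos hint
  have h : ‖r‖ ^ (minpoly ℚ_[p] r).natDegree = ‖(minpoly ℚ_[p] r).coeff 0‖ := by
    rw [← PadicAlgCl.spectralNorm_eq, spectralNorm.spectralNorm_eq_norm_coeff_zero_rpow, one_div,
      Real.rpow_inv_natCast_pow (norm_nonneg _) hd.ne']
  exact ⟨_, _, hd, minpoly.coeff_zero_ne_zero hint hr, h⟩

theorem exists_lt_dist_lt_of_norm_le {E : Type*} [NormedAddCommGroup E] [ProperSpace E]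
    {u : ℕ → E} {C : ℝ} (hu : ∀ n, ‖u n‖ ≤ C) {ε : ℝ} (hε : 0 < ε) :
    ∃ i j : ℕ, i < j ∧ ‖u j - u i‖ < ε := by
  obtain ⟨a, -, φ, hφ, hlim⟩ := (isCompact_closedBall (0 : E) C).tendsto_subseq
    (x := u) fun n => by simpa using hu n
  obtain ⟨N, hN⟩ := Metric.cauchySeq_iff'.1 hlim.cauchySeq ε hε
  refine ⟨φ N, φ (N + 1), hφ N.lt_succ_self, ?_⟩
  rw [← dist_eq_norm]
  exact hN (N + 1) N.le_succ

variable {ι : Type*} [Fintype ι] [DecidableEq ι]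

theorem Matrix.eventually_norm_pow_add_padic {A : Matrix ι ι ℚ_[p]} (hA : ¬ IsNilpotent A) :
    ∃ (N T : ℕ) (κ : ℝ), 0 < T ∧ ∀ n, N ≤ n → ‖A ^ (n + T)‖ = κ * ‖A ^ n‖ := by
  set f := algebraMap ℚ_[p] (PadicAlgCl p)
  have hfA (n : ℕ) : ‖(f.mapMatrix A) ^ n‖ = ‖A ^ n‖ := by
    rw [← map_pow]
    exact Matrix.norm_map_eq _ _ (PadicAlgCl.norm_extends p)
  have hfA' : ¬ IsNilpotent (f.mapMatrix A) := fun ⟨n, hn⟩ =>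
    hA ⟨n, by rw [← norm_eq_zero, ← hfA, hn, norm_zero]⟩
  obtain ⟨r, C, hr, hC0, hC⟩ := Matrix.exists_norm_pow_bounds hfA'
  simp only [hfA] at hC
  obtain ⟨T, x, hT, hx, hrx⟩ := PadicAlgCl.exists_norm_pow_eq_norm hr
  have hr0 : 0 < ‖r‖ := norm_pos_iff.2 hr
  have hx0 : 0 < ‖x‖ := norm_pos_iff.2 hx
  set u : ℕ → Matrix ι ι ℚ_[p] := fun k => (x ^ k)⁻¹ • A ^ (T * k) with hu
  have hxu (k : ℕ) : x ^ k • u k = A ^ (T * k) := smul_inv_smul₀ (pow_ne_zero k hx) _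
  have hbound (k : ℕ) : ‖u k‖ ≤ C := by
    rw [hu]
    simp only
    rw [norm_smul, norm_inv, norm_pow, inv_mul_le_iff₀ (pow_pos hx0 k), ← hrx, ← pow_mul,
      mul_comm _ C]
    exact (hC _).2
  have : ProperSpace (Matrix ι ι ℚ_[p]) := FiniteDimensional.proper ℚ_[p] _
  have : IsUltrametricDist (Matrix ι ι ℚ_[p]) :=
    inferInstanceAs (IsUltrametricDist (ι → ι → ℚ_[p]))
  -- This tolerance makes `C * ε < 1`, so the error stays strictly below the lower bound `‖r‖ ^ n`.
  obtain ⟨i, j, hij, hε⟩ := exists_lt_dist_lt_of_norm_le hbound (ε := (C + 1)⁻¹) (by positivity)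
  obtain ⟨d, hd, rfl⟩ : ∃ d, 0 < d ∧ j = i + d := ⟨j - i, by omega, by omega⟩
  refine ⟨T * i, T * d, ‖x‖ ^ d, by positivity, fun n hn => ?_⟩
  obtain ⟨k, rfl⟩ := Nat.exists_eq_add_of_le' hn
  have hdiff : A ^ (k + T * i + T * d) - x ^ d • A ^ (k + T * i)
      = x ^ (i + d) • (A ^ k * (u (i + d) - u i)) := by
    have h₁ : x ^ (i + d) • (A ^ k * u i) = x ^ d • A ^ (k + T * i) := by
      rw [pow_add x, mul_comm, mul_smul, ← mul_smul_comm, hxu, ← pow_add]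
    rw [mul_sub, smul_sub, h₁, ← mul_smul_comm, hxu, ← pow_add, mul_add, add_assoc]
  have hlt : ‖A ^ (k + T * i + T * d) - x ^ d • A ^ (k + T * i)‖ < ‖x ^ d • A ^ (k + T * i)‖ := by
    have hlow := (hC (k + T * i)).1
    rw [pow_add, pow_mul, hrx] at hlow
    rw [hdiff, norm_smul, norm_smul, norm_pow, norm_pow, pow_add, mul_comm (‖x‖ ^ i), mul_assoc]
    refine mul_lt_mul_of_pos_left ?_ (pow_pos hx0 d)
    calc ‖x‖ ^ i * ‖A ^ k * (u (i + d) - u i)‖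
        ≤ ‖x‖ ^ i * (C * ‖r‖ ^ k * (C + 1)⁻¹) := by
          gcongr
          exact (Matrix.norm_mul_le_of_ultrametric _ _).trans
            (mul_le_mul (hC k).2 hε.le (norm_nonneg _) (by positivity))
      _ = ‖r‖ ^ k * ‖x‖ ^ i * (C * (C + 1)⁻¹) := by ring
      _ < ‖r‖ ^ k * ‖x‖ ^ i * 1 := by
          refine mul_lt_mul_of_pos_left ?_ (by positivity)
          rw [← div_eq_mul_inv, div_lt_one (by positivity)]
          linarith
      _ ≤ ‖A ^ (k + T * i)‖ := by rwa [mul_one]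
  have h := IsUltrametricDist.norm_add_eq_max_of_norm_ne_norm hlt.ne
  rw [sub_add_cancel, max_eq_right hlt.le, norm_smul, norm_pow] at h
  exact h

end Padic

section EntriesGcd

attribute [local instance] Matrix.normedAddCommGroup Matrix.normedSpace

variable {m : ℕ}

theorem Matrix.entriesGcd_dvd (M : Matrix (Fin m) (Fin m) ℤ) (i j : Fin m) :
    M.entriesGcd ∣ M i j :=
  Finset.gcd_dvd (f := fun ij : Fin m × Fin m => M ij.1 ij.2) (Finset.mem_univ (i, j))

theorem Matrix.entriesGcd_ne_zero {M : Matrix (Fin m) (Fin m) ℤ} (hM : M ≠ 0) :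
    M.entriesGcd ≠ 0 := by
  intro h
  refine hM (Matrix.ext fun i j => ?_)
  have := M.entriesGcd_dvd i j
  rwa [h, zero_dvd_iff] at this

theorem Matrix.norm_map_intCast_padic (p : ℕ) [Fact p.Prime] (M : Matrix (Fin m) (Fin m) ℤ) :
    ‖M.map (Int.cast : ℤ → ℚ_[p])‖ = ‖(M.entriesGcd : ℚ_[p])‖ := by
  apply le_antisymm
  · rw [Matrix.norm_le_iff (norm_nonneg _)]
    intro i j
    obtain ⟨c, hc⟩ := M.entriesGcd_dvd i j
    rw [Matrix.map_apply, hc, Int.cast_mul, norm_mul]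
    exact mul_le_of_le_one_right (norm_nonneg _) (Padic.norm_int_le_one c)
  -- Bézout: the gcd is an integer combination of the entries.
  · obtain ⟨g, hg⟩ := Finset.gcd_eq_sum_mul (Finset.univ : Finset (Fin m × Fin m))
      fun ij => M ij.1 ij.2
    rw [Matrix.entriesGcd, hg, Int.cast_sum]
    refine IsUltrametricDist.norm_sum_le_of_forall_le_of_nonneg (norm_nonneg _) fun ij _ => ?_
    rw [Int.cast_mul, norm_mul]
    have h : ‖((M ij.1 ij.2 : ℤ) : ℚ_[p])‖ ≤ ‖M.map (Int.cast : ℤ → ℚ_[p])‖ :=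
      Matrix.norm_entry_le_entrywise_sup_norm (M.map (Int.cast : ℤ → ℚ_[p]))
    exact (mul_le_of_le_one_right (norm_nonneg _) (Padic.norm_int_le_one _)).trans h

/-- The entry gcds of the powers of a non-nilpotent matrix have only finitely many prime
divisors. -/
theorem Matrix.exists_forall_prime_dvd_entriesGcd_pow {A : Matrix (Fin m) (Fin m) ℤ}
    (hA : ¬ IsNilpotent A) :
    ∃ a : ℕ, a ≠ 0 ∧ ∀ p n : ℕ, p.Prime → (p : ℤ) ∣ (A ^ n).entriesGcd → p ∣ a := by
  have hne : A.charpoly - Polynomial.X ^ m ≠ 0 := by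
    intro h
    have h' := A.aeval_self_charpoly
    rw [sub_eq_zero.1 h, map_pow, Polynomial.aeval_X] at h'
    exact hA ⟨m, h'⟩
  obtain ⟨i, hi⟩ : ∃ i, (A.charpoly - Polynomial.X ^ m).coeff i ≠ 0 := by
    by_contra! h
    exact hne (Polynomial.ext h)
  refine ⟨_, Int.natAbs_ne_zero.2 hi, fun p n hp hpn => ?_⟩
  have : Fact p.Prime := ⟨hp⟩
  have hnil : IsNilpotent ((Int.castRingHom (ZMod p)).mapMatrix A) := by
    refine ⟨n, ?_⟩
    rw [← map_pow]
    ext j k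
    simpa [ZMod.intCast_zmod_eq_zero_iff_dvd] using hpn.trans ((A ^ n).entriesGcd_dvd j k)
  -- Nilpotent modulo `p` forces the characteristic polynomial to be `X ^ m` modulo `p`, so `p`
  -- divides the fixed nonzero coefficient chosen above.
  have h0 := (Matrix.isNilpotent_charpoly_sub_pow_of_isNilpotent hnil).eq_zero
  rw [RingHom.mapMatrix_apply, Matrix.charpoly_map, Fintype.card_fin] at h0
  have hc := congrArg (fun q => Polynomial.coeff q i) h0
  rw [← Int.natCast_dvd, ← ZMod.intCast_zmod_eq_zero_iff_dvd,
    ← eq_intCast (Int.castRingHom (ZMod p)), ← Polynomial.coeff_map]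
  simpa using hc

theorem Matrix.eventually_padicValInt_entriesGcd_pow_add {A : Matrix (Fin m) (Fin m) ℤ}
    (hA : ¬ IsNilpotent A) {p : ℕ} (hp : p.Prime) :
    ∃ (N T : ℕ) (c : ℤ), 0 < T ∧ ∀ n, N ≤ n →
      (padicValInt p (A ^ (n + T)).entriesGcd : ℤ) = padicValInt p (A ^ n).entriesGcd + c := by
  have : Fact p.Prime := ⟨hp⟩
  set B := (Int.castRingHom ℚ_[p]).mapMatrix A
  have hB (n : ℕ) : ‖B ^ n‖ = (p : ℝ) ^ (-(padicValInt p (A ^ n).entriesGcd : ℤ)) := by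
    have h0 : ((A ^ n).entriesGcd : ℚ_[p]) ≠ 0 :=
      Int.cast_ne_zero.2 (Matrix.entriesGcd_ne_zero fun h => hA ⟨n, h⟩)
    rw [← map_pow, ← Padic.valuation_intCast, ← Padic.norm_eq_zpow_neg_valuation h0]
    exact Matrix.norm_map_intCast_padic p (A ^ n)
  have hp0 : (0 : ℝ) < p := by exact_mod_cast hp.pos
  have hBnil : ¬ IsNilpotent B := fun ⟨n, hn⟩ => by
    have h := hB n
    rw [hn, norm_zero] at h
    exact (zpow_pos hp0 _).ne h
  obtain ⟨N, T, κ, hT, h⟩ := Matrix.eventually_norm_pow_add_padic hBnil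
  refine ⟨N, T, padicValInt p (A ^ (N + T)).entriesGcd - padicValInt p (A ^ N).entriesGcd, hT,
    fun n hn => ?_⟩
  have h₁ := h n hn
  have h₂ := h N le_rfl
  -- Cross-multiplying eliminates the real factor `κ` and leaves an identity between integer
  -- exponents.
  have h₃ : ‖B ^ (n + T)‖ * ‖B ^ N‖ = ‖B ^ (N + T)‖ * ‖B ^ n‖ := by
    rw [h₁, h₂]
    ring
  simp only [hB, ← zpow_add₀ hp0.ne'] at h₃
  have := zpow_right_injective₀ hp0 (by exact_mod_cast hp.one_lt.ne') h₃
  linarith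

end EntriesGcd

theorem add_mul_eq_of_eventually_add {f : ℕ → ℤ} {N T : ℕ} {c : ℤ}
    (h : ∀ n, N ≤ n → f (n + T) = f n + c) (t n : ℕ) (hn : N ≤ n) :
    f (n + T * t) = f n + t * c := by
  induction t with
  | zero => simp
  | succ t ih =>
    rw [mul_add, mul_one, ← add_assoc, h _ (by omega), ih]
    push_cast
    ring

theorem theorem2 (m : ℕ) (A : Matrix (Fin m) (Fin m) ℤ) (hA : ¬ IsNilpotent A) :
    EventuallyPeriodicSeq
      (fun n : ℕ => ((A ^ (n + 1)).entriesGcd : ℚ) / ((A ^ n).entriesGcd : ℚ)) := by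
  set d : ℕ → ℤ := fun n => (A ^ n).entriesGcd
  have hd0 (n : ℕ) : d n ≠ 0 := Matrix.entriesGcd_ne_zero fun h => hA ⟨n, h⟩
  have hnonneg (n : ℕ) : 0 ≤ d n := Int.nonneg_of_normalize_eq_self Finset.normalize_gcd
  obtain ⟨a, ha, hgood⟩ := Matrix.exists_forall_prime_dvd_entriesGcd_pow hA
  choose! N T c hT h using fun (p : ℕ) (hp : p.Prime) =>
    Matrix.eventually_padicValInt_entriesGcd_pow_add hA hp
  set P := ∏ p ∈ a.primeFactors, T p
  have hP : 0 < P := Finset.prod_pos fun p hp => hT p (Nat.prime_of_mem_primeFactors hp)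
  have hval (p : ℕ) (hp : p.Prime) : ∃ e : ℤ, ∀ n, a.primeFactors.sup N ≤ n →
      (padicValInt p (d (n + P)) : ℤ) = padicValInt p (d n) + e := by
    by_cases hpa : p ∣ a
    · have hmem : p ∈ a.primeFactors := Nat.mem_primeFactors.2 ⟨hp, hpa, ha⟩
      obtain ⟨t, ht⟩ := Finset.dvd_prod_of_mem T hmem
      refine ⟨t * c p, fun n hn => ?_⟩
      have := add_mul_eq_of_eventually_add
        (f := fun n => (padicValInt p (d n) : ℤ)) (h p hp) t n ((Finset.le_sup hmem).trans hn)
      rwa [← ht] at this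
    · have hz (n : ℕ) : padicValInt p (d n) = 0 :=
        padicValInt.eq_zero_of_not_dvd fun hdvd => hpa (hgood p n hp hdvd)
      exact ⟨0, fun n _ => by simp [hz]⟩
  refine ⟨a.primeFactors.sup N, P, hP, fun n hn => ?_⟩
  -- At each prime the increment `e` is the same at `n` and `n + 1`, so it cancels.
  have hnat : (d (n + P + 1)).natAbs * (d n).natAbs = (d (n + 1)).natAbs * (d (n + P)).natAbs := by
    have h0 (k : ℕ) : (d k).natAbs ≠ 0 := Int.natAbs_ne_zero.2 (hd0 k)
    refine Nat.eq_of_factorization_eq (mul_ne_zero (h0 _) (h0 _)) (mul_ne_zero (h0 _) (h0 _))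
      fun p => ?_
    by_cases hp : p.Prime
    · obtain ⟨e, he⟩ := hval p hp
      have h₁ := he n hn
      have h₂ := he (n + 1) (hn.trans n.le_succ)
      rw [Nat.factorization_mul (h0 _) (h0 _), Nat.factorization_mul (h0 _) (h0 _)]
      simp only [Finsupp.add_apply, Nat.factorization_def _ hp]
      simp only [padicValInt, show n + 1 + P = n + P + 1 by ring] at h₁ h₂
      omega
    · simp [Nat.factorization_eq_zero_of_not_prime _ hp]
  have hint : d (n + P + 1) * d n = d (n + 1) * d (n + P) := by
    zify at hnat
    simpa only [abs_of_nonneg (hnonneg _)] using hnat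
  have hq (k : ℕ) : (d k : ℚ) ≠ 0 := Int.cast_ne_zero.2 (hd0 k)
  change (d (n + P + 1) : ℚ) / d (n + P) = d (n + 1) / d n
  rw [div_eq_div_iff (hq _) (hq _)]
  exact_mod_cast hint
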